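/- Let $\mathsf B$ be a locally presentable abelian category and let $P\in\mathsf B$ be a projective generator, that is, a projective object such that the functor $\operatorname{Hom}_{\mathsf B}(P,-)$ is faithful. Let $R$ be an associative unital ring, let $\theta\colon R\to\operatorname{Hom}_{\mathsf B}(P,P)^{\mathrm{op}}$ be a ring homomorphism (the multiplication of $\operatorname{Hom}_{\mathsf B}(P,P)$ being the composition of maps), and let $\Theta=\operatorname{Hom}_{\mathsf B}(P,-)\colon\mathsf B\to R\text{-}\mathrm{mod}$ be the resulting exact functor to the category of left $R$-modules, where $R$ acts on $\operatorname{Hom}_{\mathsf B}(P,B)$ by $r\cdot f=f\circ\theta(r)$. Then the following two conditions are equivalent: (i) the maps $\operatorname{Ext}^i_{\mathsf B}(B,C)\to\operatorname{Ext}^i_R(\Theta(B),\Theta(C))$ induced by $\Theta$ are isomorphisms for all objects $B,C\in\mathsf B$ and all integers $i\ge 0$; (ii) the triangulated functor $\mathsf D^-(\mathsf B)\to\mathsf D^-(R\text{-}\mathrm{mod})$ between the bounded above derived categories induced by $\Theta$ is fully faithful. -/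

import Mathlib

open CategoryTheory Limits

universe w₁ w₂ w₃ v v₁ v₂ u u₁ u₂

noncomputable section

namespace CategoryTheory.Functor

open DerivedCategory.TStructure

variable {C : Type u₁} [Category.{v₁} C] [Abelian C] [HasDerivedCategory.{w₁} C]
  {D : Type u₂} [Category.{v₂} D] [Abelian D] [HasDerivedCategory.{w₂} D]
  (F : C ⥤ D) [F.Additive] [PreservesFiniteLimits F] [PreservesFiniteColimits F]

/-- The functor on derived categories induced by an exact functor preserves the
bounded above objects. -/
lemma minus_mapDerivedCategory_obj (X : DerivedCategory.Minus C) :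
    (t : Triangulated.TStructure (DerivedCategory D)).minus
      (F.mapDerivedCategory.obj X.obj) := by
  obtain ⟨X, n, K, e, h⟩ := X
  refine ⟨n, ⟨(F.mapHomologicalComplex (ComplexShape.up ℤ)).obj K,
    F.mapDerivedCategory.mapIso e ≪≫ F.mapDerivedCategoryFactors.app K, ⟨fun i hi ↦ ?_⟩⟩⟩
  exact F.map_isZero (h.isZero i hi)

/-- The functor `D⁻(C) ⥤ D⁻(D)` induced by an exact functor `F : C ⥤ D` between abelian
categories: the restriction of `F.mapDerivedCategory : D(C) ⥤ D(D)`, which applies `F` to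
complexes termwise. -/
def mapDerivedCategoryMinus : DerivedCategory.Minus C ⥤ DerivedCategory.Minus D :=
  t.minus.lift (DerivedCategory.Minus.ι ⋙ F.mapDerivedCategory)
    F.minus_mapDerivedCategory_obj

instance : F.mapDerivedCategoryMinus.CommShift ℤ := by
  dsimp only [mapDerivedCategoryMinus]
  infer_instance

instance : F.mapDerivedCategoryMinus.IsTriangulated := by
  dsimp only [mapDerivedCategoryMinus]
  infer_instance

end CategoryTheory.Functor

section

variable {B : Type u} [Category.{v} B] [Abelian B] (P : B) {R : Type v} [Ring R]
  (θ : R →+* (End P)ᵐᵒᵖ)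

/-- The functor `Hom(P, -)` from an abelian category to left `R`-modules, where `R` acts on
`Hom(P, X)` by `r • f = f ∘ θ(r)` through a ring homomorphism `θ` from `R` to the opposite
ring of the endomorphism ring of `P`. -/
def homFunctor : B ⥤ ModuleCat.{v} R :=
  preadditiveCoyonedaObj P ⋙ ModuleCat.restrictScalars θ

instance : (homFunctor P θ).Additive := by
  dsimp only [homFunctor]; infer_instance

instance : PreservesFiniteLimits (homFunctor P θ) := by
  have : PreservesFiniteLimits (preadditiveCoyonedaObj P) := ⟨fun J _ _ ↦ inferInstance⟩
  have : PreservesFiniteLimits (ModuleCat.restrictScalars.{v} θ) :=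
    ⟨fun J _ _ ↦ ⟨inferInstance⟩⟩
  exact comp_preservesFiniteLimits _ _

instance [Projective P] : PreservesFiniteColimits (homFunctor P θ) := by
  dsimp only [homFunctor]; infer_instance

end

end

/-! Since `Ext^i(X, Y)` is `Hom(X, Y[i])` in the derived category, (ii) gives (i) by evaluating on
stalk complexes.

For (i) ⇒ (ii), bijectivity on `Hom(X, Y[n])` for all `n` cuts out a triangulated subcategory in
either variable, by the five lemma. Dévissage along the t-structure passes from objects of the
abelian category to bounded `X`. Bounded above `X` then follow when `Y` is a stalk, as the part of
`X` in degrees below `Y[n]` has no maps to it (`bijectiveOn_mapDerivedCategory_of_isGE`).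

For `Y` bounded above, dévissage does not terminate. Instead `Y` is the limit of its bounded
truncations `τ_{≥-n} Y`, through a short exact sequence `0 → Y → ∏ → ∏ → 0`
(`exists_shortExact_truncGE`). A projective separator makes products exact, so termwise products are
products in the derived category (`existsUnique_lift_of_isTermwiseProduct`). This applies over `B`
and over `R`, and `Hom(P, -)` preserves products. -/

namespace CategoryTheory.Functor

open Pretriangulated

/-! ### Bijectivity on Hom sets and the five lemma -/

section

variable {C : Type u₁} [Category.{v₁} C] {D : Type u₂} [Category.{v₂} D] (F : C ⥤ D)

/-- The property that `F` induces a bijection `(X ⟶ Y) → (F.obj X ⟶ F.obj Y)`. -/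
def BijectiveOn (X Y : C) : Prop :=
  Function.Bijective (F.map : (X ⟶ Y) → (F.obj X ⟶ F.obj Y))

variable {F}

lemma BijectiveOn.of_iso {X Y X' Y' : C} (h : F.BijectiveOn X Y) (e : X ≅ X') (e' : Y ≅ Y') :
    F.BijectiveOn X' Y' := by
  constructor
  · intro f g hfg
    have : e.hom ≫ f ≫ e'.inv = e.hom ≫ g ≫ e'.inv := h.1 (by simp [hfg])
    simpa using this
  · intro f
    obtain ⟨g, hg⟩ := h.2 (F.map e.hom ≫ f ≫ F.map e'.inv)
    refine ⟨e.inv ≫ g ≫ e'.hom, ?_⟩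
    simp only [Functor.map_comp, hg, Category.assoc]
    simp only [← Functor.map_comp, Iso.inv_hom_id, Functor.map_id, Category.comp_id]
    simp only [← Functor.map_comp_assoc, Iso.inv_hom_id, Functor.map_id, Category.id_comp]

lemma bijectiveOn_of_fullyFaithful [F.Full] [F.Faithful] (X Y : C) : F.BijectiveOn X Y :=
  ⟨F.map_injective, F.map_surjective⟩

lemma bijectiveOn_shift_iff [HasShift C ℤ] [HasShift D ℤ] [F.CommShift ℤ] (X Y : C) (a : ℤ) :
    F.BijectiveOn (X⟦a⟧) (Y⟦a⟧) ↔ F.BijectiveOn X Y := by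
  have h₁ : Function.Bijective ((shiftFunctor C a).map : (X ⟶ Y) → _) :=
    ⟨(shiftFunctor C a).map_injective, (shiftFunctor C a).map_surjective⟩
  have h₂ : Function.Bijective ((shiftFunctor D a).map : (F.obj X ⟶ F.obj Y) → _) :=
    ⟨(shiftFunctor D a).map_injective, (shiftFunctor D a).map_surjective⟩
  let e : (F.obj (X⟦a⟧) ⟶ F.obj (Y⟦a⟧)) ≃ ((F.obj X)⟦a⟧ ⟶ (F.obj Y)⟦a⟧) :=
    Iso.homCongr ((F.commShiftIso a).app X) ((F.commShiftIso a).app Y)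
  have h : (e ∘ F.map) ∘ (shiftFunctor C a).map =
      (shiftFunctor D a).map ∘ (F.map : (X ⟶ Y) → _) := by
    ext f
    simp [e, Iso.homCongr]
  unfold BijectiveOn
  rw [← Function.Bijective.of_comp_iff _ h₁, ← Function.Bijective.of_comp_iff' e.bijective,
    ← Function.comp_assoc, h, Function.Bijective.of_comp_iff' h₂]

end

variable {C : Type u₁} [Category.{v₁} C] [Preadditive C] [HasZeroObject C] [HasShift C ℤ]
  [∀ n : ℤ, (shiftFunctor C n).Additive] [Pretriangulated C]
  {D : Type u₂} [Category.{v₂} D] [Preadditive D] [HasZeroObject D] [HasShift D ℤ]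
  [∀ n : ℤ, (shiftFunctor D n).Additive] [Pretriangulated D]
  {F : C ⥤ D} [F.CommShift ℤ] [F.IsTriangulated]

lemma exists_eq_comp_map_mor₁ {T : Triangle C} (hT : T ∈ distTriang C) {U : D}
    (f : U ⟶ F.obj T.obj₂) (hf : f ≫ F.map T.mor₂ = 0) :
    ∃ g : U ⟶ F.obj T.obj₁, f = g ≫ F.map T.mor₁ :=
  Triangle.coyoneda_exact₂ _ (F.map_distinguished T hT) f hf

lemma exists_eq_map_mor₂_comp {T : Triangle C} (hT : T ∈ distTriang C) {U : D}
    (f : F.obj T.obj₂ ⟶ U) (hf : F.map T.mor₁ ≫ f = 0) :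
    ∃ g : F.obj T.obj₃ ⟶ U, f = F.map T.mor₂ ≫ g :=
  Triangle.yoneda_exact₂ _ (F.map_distinguished T hT) f hf

lemma BijectiveOn.eq_zero {X Y : C} (h : F.BijectiveOn X Y) {f : X ⟶ Y} (hf : F.map f = 0) :
    f = 0 :=
  h.1 (by rw [hf, F.map_zero])

lemma BijectiveOn.mk' {X Y : C} (h₁ : ∀ f : X ⟶ Y, F.map f = 0 → f = 0)
    (h₂ : Function.Surjective (F.map : (X ⟶ Y) → (F.obj X ⟶ F.obj Y))) : F.BijectiveOn X Y :=
  ⟨fun f g hfg ↦ sub_eq_zero.1 (h₁ _ (by rw [F.map_sub, hfg, sub_self])), h₂⟩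

-- Extends the triangle one step to the left; keeping `d` abstract avoids the explicit form of the
-- inverse rotation in the five lemmas.
variable (F) in
lemma exists_mor₀_of_distinguished {T : Triangle C} (hT : T ∈ distTriang C) :
    ∃ (d : T.obj₃⟦(-1 : ℤ)⟧ ⟶ T.obj₁), d ≫ T.mor₁ = 0 ∧
      (∀ {U : D} (f : U ⟶ F.obj T.obj₁), f ≫ F.map T.mor₁ = 0 → ∃ g, f = g ≫ F.map d) ∧
      (∀ {U : C} (f : T.obj₁ ⟶ U), d ≫ f = 0 → ∃ g, f = T.mor₁ ≫ g) :=
  ⟨T.invRotate.mor₁, comp_distTriang_mor_zero₁₂ _ (inv_rot_of_distTriang _ hT),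
    fun f hf ↦ F.exists_eq_comp_map_mor₁ (inv_rot_of_distTriang _ hT) f hf,
    fun f hf ↦ Triangle.yoneda_exact₂ _ (inv_rot_of_distTriang _ hT) f hf⟩

/-- The five lemma for the second variable. -/
lemma BijectiveOn.of_triangle_right {X : C} {T : Triangle C} (hT : T ∈ distTriang C)
    (h₁ : F.BijectiveOn X T.obj₁) (h₃ : F.BijectiveOn X T.obj₃)
    (h₁' : F.BijectiveOn X (T.obj₁⟦(1 : ℤ)⟧)) (h₃' : F.BijectiveOn X (T.obj₃⟦(-1 : ℤ)⟧)) :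
    F.BijectiveOn X T.obj₂ := by
  refine .mk' (fun f hf ↦ ?_) (fun f ↦ ?_)
  · obtain ⟨d, hd, hd', -⟩ := F.exists_mor₀_of_distinguished hT
    obtain ⟨g, rfl⟩ := T.coyoneda_exact₂ hT f (h₃.eq_zero (by rw [F.map_comp, hf, zero_comp]))
    obtain ⟨h, hh⟩ := hd' (F.map g) (by rw [← hf, F.map_comp])
    obtain ⟨h', rfl⟩ := h₃'.2 h
    obtain rfl : g = h' ≫ d := h₁.1 (by rw [F.map_comp, hh])
    rw [Category.assoc, hd, comp_zero]
  · obtain ⟨g, hg⟩ := h₃.2 (f ≫ F.map T.mor₂)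
    obtain ⟨g', rfl⟩ := T.coyoneda_exact₃ hT g (h₁'.eq_zero (by
      rw [F.map_comp, hg, Category.assoc, ← F.map_comp, comp_distTriang_mor_zero₂₃ _ hT,
        F.map_zero, comp_zero]))
    obtain ⟨h, hh⟩ := F.exists_eq_comp_map_mor₁ hT (f - F.map g') (by
      rw [Preadditive.sub_comp, ← hg, F.map_comp, sub_self])
    obtain ⟨h', rfl⟩ := h₁.2 h
    exact ⟨g' + h' ≫ T.mor₁, by rw [F.map_add, F.map_comp, ← hh, add_sub_cancel]⟩

/-- The five lemma for the first variable. -/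
lemma BijectiveOn.of_triangle_left {Y : C} {T : Triangle C} (hT : T ∈ distTriang C)
    (h₁ : F.BijectiveOn T.obj₁ Y) (h₃ : F.BijectiveOn T.obj₃ Y)
    (h₁' : F.BijectiveOn (T.obj₁⟦(1 : ℤ)⟧) Y) (h₃' : F.BijectiveOn (T.obj₃⟦(-1 : ℤ)⟧) Y) :
    F.BijectiveOn T.obj₂ Y := by
  refine .mk' (fun f hf ↦ ?_) (fun f ↦ ?_)
  · obtain ⟨g, rfl⟩ := T.yoneda_exact₂ hT f (h₁.eq_zero (by rw [F.map_comp, hf, comp_zero]))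
    obtain ⟨h, hh⟩ : ∃ h, F.map g = F.map T.mor₃ ≫ h :=
      F.exists_eq_map_mor₂_comp (rot_of_distTriang _ hT) (F.map g) ((F.map_comp _ _).symm.trans hf)
    obtain ⟨h', rfl⟩ := h₁'.2 h
    obtain rfl : g = T.mor₃ ≫ h' := h₃.1 (by rw [F.map_comp, hh])
    rw [comp_distTriang_mor_zero₂₃_assoc _ hT, zero_comp]
  · obtain ⟨d, hd, -, hd'⟩ := F.exists_mor₀_of_distinguished hT
    obtain ⟨g, hg⟩ := h₁.2 (F.map T.mor₁ ≫ f)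
    obtain ⟨g', rfl⟩ := hd' g (h₃'.eq_zero (by
      rw [F.map_comp, hg, ← F.map_comp_assoc, hd, F.map_zero, zero_comp]))
    obtain ⟨h, hh⟩ := F.exists_eq_map_mor₂_comp hT (f - F.map g') (by
      rw [Preadditive.comp_sub, ← hg, F.map_comp, sub_self])
    obtain ⟨h', rfl⟩ := h₃.2 h
    exact ⟨g' + T.mor₂ ≫ h', by rw [F.map_add, F.map_comp, ← hh, add_sub_cancel]⟩

variable (F)

/-- The property of objects `Y` such that `F` induces bijections on `Hom(X, Y⟦n⟧)` for all `n`. -/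
def bijectiveOnRight (X : C) : ObjectProperty C :=
  fun Y ↦ ∀ n : ℤ, F.BijectiveOn X (Y⟦n⟧)

/-- The property of objects `X` such that `F` induces bijections on `Hom(X, Y⟦n⟧)` for all `n`. -/
def bijectiveOnLeft (Y : C) : ObjectProperty C :=
  fun X ↦ ∀ n : ℤ, F.BijectiveOn X (Y⟦n⟧)

instance (X : C) : (F.bijectiveOnRight X).IsClosedUnderIsomorphisms where
  of_iso e h n := (h n).of_iso (Iso.refl _) ((shiftFunctor C n).mapIso e)

instance (Y : C) : (F.bijectiveOnLeft Y).IsClosedUnderIsomorphisms where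
  of_iso e h n := (h n).of_iso e (Iso.refl _)

instance (X : C) : (F.bijectiveOnRight X).IsTriangulated where
  exists_zero := ⟨_, isZero_zero C, fun n ↦ .mk'
    (fun _ _ ↦ ((shiftFunctor C n).map_isZero (isZero_zero C)).eq_of_tgt _ _)
    (fun _ ↦ ⟨0, (F.map_isZero ((shiftFunctor C n).map_isZero (isZero_zero C))).eq_of_tgt _ _⟩)⟩
  isStableUnderShiftBy a :=
    ⟨fun Y hY n ↦ (hY (a + n)).of_iso (Iso.refl _) ((shiftFunctorAdd C a n).app Y)⟩
  ext₂' T hT h₁ h₃ := ObjectProperty.le_isoClosure _ _ (fun n ↦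
    .of_triangle_right (Triangle.shift_distinguished T hT n) (h₁ n) (h₃ n)
      ((h₁ (n + 1)).of_iso (Iso.refl _) ((shiftFunctorAdd C n 1).app _))
      ((h₃ (n + -1)).of_iso (Iso.refl _) ((shiftFunctorAdd C n (-1)).app _)))

instance (Y : C) : (F.bijectiveOnLeft Y).IsStableUnderShift ℤ where
  isStableUnderShiftBy a :=
    ⟨fun X hX n ↦ ((F.bijectiveOn_shift_iff X _ a).2 (hX (n - a))).of_iso (Iso.refl _)
      ((shiftFunctorAdd' C (n - a) a n (by lia)).symm.app Y)⟩

instance (Y : C) : (F.bijectiveOnLeft Y).IsTriangulated where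
  exists_zero := ⟨_, isZero_zero C, fun _ ↦ .mk'
    (fun _ _ ↦ (isZero_zero C).eq_of_src _ _)
    (fun _ ↦ ⟨0, (F.map_isZero (isZero_zero C)).eq_of_src _ _⟩)⟩
  ext₂' _ hT h₁ h₃ := ObjectProperty.le_isoClosure _ _ (fun n ↦
    .of_triangle_left hT (h₁ n) (h₃ n) ((F.bijectiveOnLeft Y).le_shift 1 _ h₁ n)
      ((F.bijectiveOnLeft Y).le_shift (-1) _ h₃ n))

end CategoryTheory.Functor

/-! ### Dévissage of bounded objects -/

namespace DerivedCategory

open TStructure Pretriangulated Triangulated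

variable {C : Type u} [Category.{v} C] [Abelian C] [HasDerivedCategory.{w₁} C]

/-- A triangulated subcategory of the derived category which contains the objects of the
abelian category contains all the bounded objects. -/
lemma prop_of_isGE_of_isLE (S : ObjectProperty (DerivedCategory C)) [S.IsTriangulated]
    [S.IsClosedUnderIsomorphisms] (hS : ∀ X : C, S ((singleFunctor C 0).obj X))
    (Y : DerivedCategory C) (a b : ℤ) [Y.IsGE a] [Y.IsLE b] : S Y := by
  have h₀ (Y : DerivedCategory C) (a : ℤ) [Y.IsGE a] [Y.IsLE a] : S Y := by
    obtain ⟨X, ⟨e⟩⟩ := exists_iso_singleFunctor_obj_of_isGE_of_isLE Y a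
    exact S.prop_of_iso (((singleFunctors C).shiftIso (-a) a 0 (by simp)).app X ≪≫ e.symm)
      (S.le_shift (-a) _ (hS X))
  by_cases hab : a ≤ b
  · obtain ⟨n, rfl⟩ := Int.le.dest hab
    clear hab
    -- Induction on the amplitude, splitting off the lowest cohomology object with a truncation
    -- triangle.
    induction n generalizing Y a with
    | zero =>
      have : Y.IsLE a := by simpa using (inferInstance : Y.IsLE (a + (0 : ℕ)))
      exact h₀ Y a
    | succ n hn =>
      have h₁ : S ((t.truncLT (a + 1)).obj Y) := h₀ _ a
      have : ((t.truncGE (a + 1)).obj Y).IsLE (a + 1 + n) :=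
        t.isLE_of_le _ (a + (n + 1 : ℕ)) _ (by push_cast; lia)
      have h₃ : S ((t.truncGE (a + 1)).obj Y) := hn _ (a + 1)
      exact S.ext_of_isTriangulatedClosed₂ _ (t.triangleLTGE_distinguished (a + 1) Y) h₁ h₃
  · exact S.prop_of_isZero (t.isZero Y b a)

end DerivedCategory

/-! ### Exactness of products and products in the derived category -/

section

variable {A : Type u} [Category.{v} A] [Abelian A] {P : A}

lemma CategoryTheory.IsSeparator.epi_of_exists_lift (hP : IsSeparator P) {X Y : A} (f : X ⟶ Y)
    (h : ∀ y : P ⟶ Y, ∃ x, x ≫ f = y) : Epi f :=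
  Preadditive.epi_of_cancel_zero _ (fun {Z} g hg ↦ hP.def _ _ (fun y ↦ by
    obtain ⟨x, rfl⟩ := h y
    rw [Category.assoc, hg, comp_zero, comp_zero]))

namespace HomologicalComplex

variable {ι : Type*} {c : ComplexShape ι} {K L : HomologicalComplex A c} (φ : K ⟶ L)
  (hP : IsSeparator P) [Projective P]

-- Refinements can be tested on `P`: an epimorphism onto `P` splits, and conversely a pullback
-- projection is epi once all `P`-points lift along it. Unlike refinements, `P`-points can be chosen
-- simultaneously for all factors of a product.
include hP in
lemma mono_homologyMap_iff_of_isSeparator (i j k : ι) (hi : c.prev j = i) (hk : c.next j = k) :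
    Mono (homologyMap φ j) ↔
      ∀ (x₂ : P ⟶ K.X j) (_ : x₂ ≫ K.d j k = 0) (y₁ : P ⟶ L.X i)
          (_ : x₂ ≫ φ.f j = y₁ ≫ L.d i j), ∃ x₁ : P ⟶ K.X i, x₂ = x₁ ≫ K.d i j := by
  rw [mono_homologyMap_iff_up_to_refinements φ i j k hi hk]
  refine ⟨fun h x₂ hx₂ y₁ hy ↦ ?_, fun h Z x₂ hx₂ y₁ hy ↦ ?_⟩
  · obtain ⟨Z, π, _, x₁, hx₁⟩ := h x₂ hx₂ y₁ hy
    exact ⟨Projective.factorThru (𝟙 P) π ≫ x₁, by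
      rw [Category.assoc, ← hx₁, Projective.factorThru_comp_assoc, Category.id_comp]⟩
  · refine ⟨_, pullback.fst x₂ (K.d i j), hP.epi_of_exists_lift _ (fun z ↦ ?_),
      pullback.snd _ _, pullback.condition⟩
    obtain ⟨x₁, hx₁⟩ := h (z ≫ x₂) (by simp [hx₂]) (z ≫ y₁) (by simp [hy])
    exact ⟨pullback.lift z x₁ hx₁, pullback.lift_fst _ _ _⟩

include hP in
lemma epi_homologyMap_iff_of_isSeparator (i j k : ι) (hi : c.prev j = i) (hk : c.next j = k) :
    Epi (homologyMap φ j) ↔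
      ∀ (y₂ : P ⟶ L.X j) (_ : y₂ ≫ L.d j k = 0),
        ∃ (x₂ : P ⟶ K.X j) (_ : x₂ ≫ K.d j k = 0) (y₁ : P ⟶ L.X i),
          y₂ = x₂ ≫ φ.f j + y₁ ≫ L.d i j := by
  rw [epi_homologyMap_iff_up_to_refinements φ i j k hi hk]
  refine ⟨fun h y₂ hy₂ ↦ ?_, fun h Z y₂ hy₂ ↦ ?_⟩
  · obtain ⟨Z, π, _, x₂, hx₂, y₁, hy⟩ := h y₂ hy₂
    refine ⟨Projective.factorThru (𝟙 P) π ≫ x₂, by rw [Category.assoc, hx₂, comp_zero],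
      Projective.factorThru (𝟙 P) π ≫ y₁, ?_⟩
    rw [Category.assoc, Category.assoc, ← Preadditive.comp_add, ← hy,
      Projective.factorThru_comp_assoc, Category.id_comp]
  · let q : kernel (K.d j k) ⊞ L.X i ⟶ L.X j :=
      biprod.desc (kernel.ι _ ≫ φ.f j) (L.d i j)
    refine ⟨_, pullback.fst y₂ q, hP.epi_of_exists_lift _ (fun z ↦ ?_),
      pullback.snd _ _ ≫ biprod.fst ≫ kernel.ι _, by simp, pullback.snd _ _ ≫ biprod.snd, ?_⟩
    · obtain ⟨x₂, hx₂, y₁, hy⟩ := h (z ≫ y₂) (by simp [hy₂])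
      exact ⟨pullback.lift z (biprod.lift (kernel.lift _ x₂ hx₂) y₁) (by simp [q, hy]),
        pullback.lift_fst _ _ _⟩
    · rw [pullback.condition]
      simp only [Category.assoc, ← Preadditive.comp_add]
      congr 1
      ext <;> simp [q]

end HomologicalComplex

namespace CochainComplex

variable {J : Type w₁}

/-- A family of morphisms of cochain complexes `p j : T ⟶ K j` identifies `T` to the product of
the complexes `K j` in each degree. -/
def IsTermwiseProduct {K : J → CochainComplex A ℤ} {T : CochainComplex A ℤ}
    (p : ∀ j, T ⟶ K j) : Prop :=
  ∀ (i : ℤ) {Z : A} (x : ∀ j, Z ⟶ (K j).X i), ∃! y : Z ⟶ T.X i, ∀ j, y ≫ (p j).f i = x j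

lemma exists_isTermwiseProduct [HasProductsOfShape J A] (K : J → CochainComplex A ℤ) :
    ∃ (T : CochainComplex A ℤ) (p : ∀ j, T ⟶ K j), IsTermwiseProduct p := by
  refine ⟨∏ᶜ K, Pi.π K, fun i Z x ↦ ?_⟩
  have h := isLimitFanMkObjOfIsLimit (HomologicalComplex.eval A (.up ℤ) i) K (Pi.π K)
    (productIsProduct K)
  exact ⟨Fan.IsLimit.lift h x, fun j ↦ Fan.IsLimit.fac h x j, fun y hy ↦
    Fan.IsLimit.hom_ext h _ _ (fun j ↦ (hy j).trans (Fan.IsLimit.fac h x j).symm)⟩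

namespace IsTermwiseProduct

variable {K : J → CochainComplex A ℤ} {T : CochainComplex A ℤ} {p : ∀ j, T ⟶ K j}
  (hp : IsTermwiseProduct p)

include hp

lemma hom_ext {i : ℤ} {Z : A} {x y : Z ⟶ T.X i} (h : ∀ j, x ≫ (p j).f i = y ≫ (p j).f i) :
    x = y :=
  (hp i _).unique h (fun _ ↦ rfl)

lemma exists_lift {X : CochainComplex A ℤ} (f : ∀ j, X ⟶ K j) :
    ∃ g : X ⟶ T, ∀ j, g ≫ p j = f j := by
  choose g hg _ using fun i ↦ hp i (fun j ↦ (f j).f i)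
  exact ⟨{ f := g, comm' := fun i j _ ↦ hp.hom_ext (fun k ↦ by
            rw [Category.assoc, Category.assoc, ← (p k).comm, reassoc_of% hg, hg, (f k).comm]) },
    fun j ↦ by ext i; exact hg i j⟩

lemma exists_homotopy_zero {X : CochainComplex A ℤ} (f : X ⟶ T)
    (h : ∀ j, Nonempty (Homotopy (f ≫ p j) 0)) : Nonempty (Homotopy f 0) := by
  choose g hg _ using fun i k ↦ hp k (fun j ↦ (h j).some.hom i k)
  refine ⟨{ hom := g, zero := fun i k hik ↦ hp.hom_ext (fun j ↦ ?_),
            comm := fun i ↦ hp.hom_ext (fun j ↦ ?_) }⟩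
  · rw [hg, (h j).some.zero i k hik, zero_comp]
  · have := (h j).some.comm i
    simp only [HomologicalComplex.comp_f, HomologicalComplex.zero_f, add_zero] at this ⊢
    rw [this, Preadditive.add_comp, ← dNext_comp_right, ← prevD_comp_right]
    simp only [hg]

lemma shift (a : ℤ) : IsTermwiseProduct (fun j ↦ (p j)⟦a⟧') :=
  fun i _ x ↦ hp (i + a) x

lemma map {A' : Type u₁} [Category.{v₁} A'] [Abelian A'] (F : A ⥤ A') [F.Additive]
    [PreservesLimitsOfShape (Discrete J) F] :
    IsTermwiseProduct (fun j ↦ (F.mapHomologicalComplex (.up ℤ)).map (p j)) := by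
  intro i Z x
  choose l hl hl' using fun (Z : A) (x : ∀ j, Z ⟶ (K j).X i) ↦ hp i x
  have h₀ : IsLimit (Fan.mk (T.X i) (fun j ↦ (p j).f i)) :=
    Fan.IsLimit.mk _ (fun s ↦ l _ s.proj) (fun s j ↦ hl _ s.proj j) (fun s m hm ↦ hl' _ s.proj m hm)
  have h := isLimitFanMkObjOfIsLimit F _ _ h₀
  exact ⟨Fan.IsLimit.lift h x, fun j ↦ Fan.IsLimit.fac h x j, fun y hy ↦
    Fan.IsLimit.hom_ext h _ _ (fun j ↦ (hy j).trans (Fan.IsLimit.fac h x j).symm)⟩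

/-- In an abelian category with a projective separator, products of quasi-isomorphisms are
quasi-isomorphisms. -/
lemma quasiIso (hP : IsSeparator P) [Projective P] {L : J → CochainComplex A ℤ}
    {U : CochainComplex A ℤ} {q : ∀ j, U ⟶ L j} (hq : IsTermwiseProduct q) (s : ∀ j, K j ⟶ L j)
    [∀ j, QuasiIso (s j)] (φ : T ⟶ U) (hφ : ∀ j, φ ≫ q j = p j ≫ s j) : QuasiIso φ := by
  have hφ' (i : ℤ) (j : J) : φ.f i ≫ (q j).f i = (p j).f i ≫ (s j).f i := by
    rw [← HomologicalComplex.comp_f, hφ, HomologicalComplex.comp_f]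
  have hs (j : J) (i : ℤ) : IsIso (HomologicalComplex.homologyMap (s j) i) := inferInstance
  rw [quasiIso_iff]
  intro i
  rw [quasiIsoAt_iff_isIso_homologyMap]
  have : Mono (HomologicalComplex.homologyMap φ i) := by
    rw [HomologicalComplex.mono_homologyMap_iff_of_isSeparator φ hP _ i _ rfl rfl]
    intro x₂ hx₂ y₁ hy
    have h (j : J) : ∃ x₁, x₂ ≫ (p j).f i = x₁ ≫ (K j).d _ i :=
      (HomologicalComplex.mono_homologyMap_iff_of_isSeparator (s j) hP _ i _ rfl rfl).1
        inferInstance (x₂ ≫ (p j).f i) (by simp [reassoc_of% hx₂]) (y₁ ≫ (q j).f _) (by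
          rw [Category.assoc, Category.assoc, ← hφ', reassoc_of% hy, (q j).comm])
    choose x₁ hx₁ using h
    obtain ⟨x, hx, -⟩ := hp _ x₁
    exact ⟨x, hp.hom_ext (fun j ↦ by
      rw [hx₁, Category.assoc, ← (p j).comm, reassoc_of% hx])⟩
  have : Epi (HomologicalComplex.homologyMap φ i) := by
    rw [HomologicalComplex.epi_homologyMap_iff_of_isSeparator φ hP _ i _ rfl rfl]
    intro y₂ hy₂
    have h (j : J) := (HomologicalComplex.epi_homologyMap_iff_of_isSeparator (s j) hP _ i _
      rfl rfl).1 inferInstance (y₂ ≫ (q j).f i) (by simp [reassoc_of% hy₂])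
    choose x₂ hx₂ y₁ hy using h
    obtain ⟨x, hx, -⟩ := hp _ x₂
    obtain ⟨y, hy', -⟩ := hq _ y₁
    refine ⟨x, hp.hom_ext (fun j ↦ ?_), y, hq.hom_ext (fun j ↦ ?_)⟩
    · rw [Category.assoc, ← (p j).comm, reassoc_of% hx, hx₂, zero_comp]
    · rw [hy, Preadditive.add_comp, Category.assoc, hφ', reassoc_of% hx, Category.assoc,
        ← (q j).comm, reassoc_of% hy']
  exact isIso_of_mono_of_epi _

end IsTermwiseProduct

end CochainComplex

namespace DerivedCategory

variable [HasDerivedCategory.{w₂} A]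

/-- `Q` is, through the homotopy category, a localization with a calculus of left fractions. -/
lemma exists_quasiIso_homotopy_zero_of_Q_map_eq_zero {X Y : CochainComplex A ℤ} (f : X ⟶ Y)
    (hf : Q.map f = 0) :
    ∃ (Z : CochainComplex A ℤ) (s : Y ⟶ Z), QuasiIso s ∧ Nonempty (Homotopy (f ≫ s) 0) := by
  have h : Qh.map ((HomotopyCategory.quotient A (.up ℤ)).map f) = Qh.map 0 := by
    rw [Qh.map_zero, ← cancel_mono ((quotientCompQhIso A).hom.app Y),
      quotientCompQhIso_hom_naturality, hf, comp_zero, zero_comp]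
  rw [MorphismProperty.map_eq_iff_postcomp Qh (HomotopyCategory.quasiIso A (.up ℤ))] at h
  obtain ⟨Z, s, hs, fac⟩ := h
  obtain ⟨Z, rfl⟩ := HomotopyCategory.quotient_obj_surjective Z
  obtain ⟨s, rfl⟩ := (HomotopyCategory.quotient _ _).map_surjective s
  refine ⟨Z, s, (HomotopyCategory.quotient_map_mem_quasiIso_iff s).1 hs,
    ⟨HomotopyCategory.homotopyOfEq _ _ ?_⟩⟩
  rw [Functor.map_comp, fac, zero_comp, Functor.map_zero]

/-- In an abelian category with a projective separator and products, termwise products of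
complexes are products in the derived category. -/
lemma existsUnique_lift_of_isTermwiseProduct {J : Type w₁} [HasProductsOfShape J A]
    (hP : IsSeparator P) [Projective P]
    {K : J → CochainComplex A ℤ} {T : CochainComplex A ℤ} {p : ∀ j, T ⟶ K j}
    (hp : CochainComplex.IsTermwiseProduct p) {X : DerivedCategory A}
    (f : ∀ j, X ⟶ Q.obj (K j)) : ∃! g : X ⟶ Q.obj T, ∀ j, g ≫ Q.map (p j) = f j := by
  refine existsUnique_of_exists_of_unique ?_ ?_
  · obtain ⟨X', ⟨e⟩⟩ : ∃ X', Nonempty (Q.obj X' ≅ X) := ⟨_, ⟨Q.objObjPreimageIso X⟩⟩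
    -- The product of the denominators `s j` is again a quasi-isomorphism, so the fractions combine
    -- into one.
    choose Y g s hs fac using fun j ↦ left_fac (e.hom ≫ f j)
    have (j : J) : QuasiIso (s j) := (isIso_Q_map_iff_quasiIso _ _).1 (hs j)
    obtain ⟨U, q, hq⟩ := CochainComplex.exists_isTermwiseProduct Y
    obtain ⟨φ, hφ⟩ := hq.exists_lift (fun j ↦ p j ≫ s j)
    obtain ⟨g', hg'⟩ := hq.exists_lift g
    have : QuasiIso φ := hp.quasiIso hP hq s φ hφ
    refine ⟨e.inv ≫ Q.map g' ≫ inv (Q.map φ), fun j ↦ ?_⟩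
    rw [← cancel_epi e.hom, fac, ← cancel_mono (Q.map (s j))]
    simp only [Category.assoc, IsIso.inv_hom_id, Iso.hom_inv_id_assoc, Category.comp_id]
    rw [← Q.map_comp, ← hφ, Q.map_comp, IsIso.inv_hom_id_assoc, ← Q.map_comp, hg']
  · intro g₁ g₂ h₁ h₂
    obtain ⟨X', ⟨e⟩⟩ : ∃ X', Nonempty (Q.obj X' ≅ X) := ⟨_, ⟨Q.objObjPreimageIso X⟩⟩
    obtain ⟨X'', s, hs, g, fac⟩ := right_fac (e.hom ≫ (g₁ - g₂))
    rw [← sub_eq_zero, ← cancel_epi e.hom, comp_zero, fac, IsIso.inv_comp_eq, comp_zero]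
    have hg (j : J) : Q.map (g ≫ p j) = 0 := by
      rw [Q.map_comp, ← (IsIso.eq_inv_comp (Q.map s)).1 fac, Category.assoc, Category.assoc,
        Preadditive.sub_comp, h₁, h₂, sub_self, comp_zero, comp_zero]
    choose Y t ht ht' using fun j ↦ exists_quasiIso_homotopy_zero_of_Q_map_eq_zero _ (hg j)
    obtain ⟨U, q, hq⟩ := CochainComplex.exists_isTermwiseProduct Y
    obtain ⟨φ, hφ⟩ := hq.exists_lift (fun j ↦ p j ≫ t j)
    have : QuasiIso φ := hp.quasiIso hP hq t φ hφ
    obtain ⟨h⟩ := hq.exists_homotopy_zero (g ≫ φ) (fun j ↦ by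
      simpa only [Category.assoc, hφ] using ht' j)
    rw [← cancel_mono (Q.map φ), zero_comp, ← Q.map_comp, Q_map_eq_of_homotopy _ h, Q.map_zero]

end DerivedCategory

end

/-! ### Bounded above complexes as limits of truncations -/

section

variable {A : Type u} [Category.{v} A] [Abelian A] {P : A}

namespace CochainComplex

variable (K : CochainComplex A ℤ)

instance (n i : ℤ) : Epi ((K.πTruncGE n).f i) := by
  dsimp only [πTruncGE]
  infer_instance

/-- Degree `n` is excluded: there the truncation is the cokernel of the incoming differential. -/
lemma isIso_πTruncGE_f (n i : ℤ) (hi : n < i) : IsIso ((K.πTruncGE n).f i) := by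
  obtain ⟨k, rfl⟩ := Int.le.dest hi.le
  refine ((ComplexShape.embeddingUpIntGE n).isIso_liftExtend_f_iff _
    (K.restrictionToTruncGE'_hasLift _) (i := k) rfl).2 (K.isIso_restrictionToTruncGE' _ _ ?_)
  rw [ComplexShape.boundaryGE_embeddingUpIntGE_iff]
  lia

lemma exists_truncGE_transition (m n : ℤ) (h : m < n) :
    ∃ r : K.truncGE m ⟶ K.truncGE n, K.πTruncGE m ≫ r = K.πTruncGE n := by
  have : Epi (K.πTruncGE m) := HomologicalComplex.epi_of_epi_f _ (fun _ ↦ inferInstance)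
  refine ⟨Abelian.epiDesc (K.πTruncGE m) (K.πTruncGE n) ?_, Abelian.comp_epiDesc _ _ _⟩
  ext i
  by_cases hi : m < i
  · have := K.isIso_πTruncGE_f m i hi
    have h₀ : (kernel.ι (K.πTruncGE m)).f i = 0 := by
      rw [← cancel_mono ((K.πTruncGE m).f i), ← HomologicalComplex.comp_f, kernel.condition,
        HomologicalComplex.zero_f, zero_comp]
    rw [HomologicalComplex.comp_f, h₀, zero_comp, HomologicalComplex.zero_f]
  · exact (isZero_of_isStrictlyGE _ n i (by lia)).eq_of_tgt _ _

/-- A complex `K` is the inverse limit of its canonical truncations, and, as soon as the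
abelian category has countable products and a projective separator, this presents `K` as
the kernel of an epimorphism between termwise products of truncations. -/
lemma exists_shortExact_truncGE [HasProductsOfShape ℕ A] (hP : IsSeparator P) [Projective P] :
    ∃ (T : CochainComplex A ℤ) (p : ∀ n : ℕ, T ⟶ K.truncGE (-n : ℤ))
      (f : K ⟶ T) (g : T ⟶ T) (zero : f ≫ g = 0),
      IsTermwiseProduct p ∧ (ShortComplex.mk f g zero).ShortExact := by
  choose r hr using fun n : ℕ ↦
    K.exists_truncGE_transition (-(n + 1 : ℕ) : ℤ) (-n : ℤ) (by lia)
  obtain ⟨T, p, hp⟩ := exists_isTermwiseProduct (fun n : ℕ ↦ K.truncGE (-n : ℤ))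
  obtain ⟨f, hf⟩ := hp.exists_lift (fun n ↦ K.πTruncGE (-n : ℤ))
  obtain ⟨g, hg⟩ := hp.exists_lift (fun n ↦ p n - p (n + 1) ≫ r n)
  have hr' (n : ℕ) (i : ℤ) : (K.πTruncGE (-(n + 1 : ℕ) : ℤ)).f i ≫ (r n).f i =
      (K.πTruncGE (-n : ℤ)).f i := by rw [← HomologicalComplex.comp_f, hr]
  have hf' (n : ℕ) (i : ℤ) : f.f i ≫ (p n).f i = (K.πTruncGE (-n : ℤ)).f i := by
    rw [← HomologicalComplex.comp_f, hf]
  have hg' (n : ℕ) (i : ℤ) : g.f i ≫ (p n).f i = (p n).f i - (p (n + 1)).f i ≫ (r n).f i := by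
    rw [← HomologicalComplex.comp_f, hg, HomologicalComplex.sub_f_apply, HomologicalComplex.comp_f]
  have zero : f ≫ g = 0 := by
    ext i
    exact hp.hom_ext (fun n ↦ by
      rw [HomologicalComplex.comp_f, Category.assoc, hg', Preadditive.comp_sub, hf',
        reassoc_of% hf', hr', sub_self, HomologicalComplex.zero_f, zero_comp])
  refine ⟨T, p, f, g, zero, hp,
    HomologicalComplex.shortExact_of_degreewise_shortExact _ (fun i ↦ ?_)⟩
  -- From `N` on, `-n < i` strictly, so the tower is constant in degree `i`.
  let N := (-i).toNat + 1
  have hiso (n : ℕ) (hn : N ≤ n) : IsIso ((K.πTruncGE (-n : ℤ)).f i) :=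
    K.isIso_πTruncGE_f _ _ (by lia)
  have hN := hiso N le_rfl
  have hmono : Mono (f.f i) := mono_of_mono_fac (hf' N i)
  have hepi : Epi (g.f i) := hP.epi_of_exists_lift _ (fun y ↦ by
    have (n : ℕ) : Epi ((r n).f i) := epi_of_epi_fac (hr' n i)
    -- Mittag-Leffler: solve `b n - r n (b (n + 1)) = y n` recursively from `0`, lifting along the
    -- epimorphisms `r n`.
    let b (n : ℕ) : P ⟶ (K.truncGE (-n : ℤ)).X i :=
      n.rec 0 (fun n b ↦ Projective.factorThru (b - y ≫ (p n).f i) ((r n).f i))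
    obtain ⟨x, hx, -⟩ := hp i b
    refine ⟨x, hp.hom_ext (fun n ↦ ?_)⟩
    have hb : b (n + 1) ≫ (r n).f i = b n - y ≫ (p n).f i := Projective.factorThru_comp _ _
    rw [Category.assoc, hg', Preadditive.comp_sub, hx, reassoc_of% hx, hb, sub_sub_cancel])
  suffices ∀ {Z : A} (x : Z ⟶ T.X i), x ≫ g.f i = 0 → ∃ y, x = y ≫ f.f i by
    refine ShortComplex.ShortExact.mk' ?_ hmono hepi
    rw [ShortComplex.exact_iff_exact_up_to_refinements]
    intro Z x hx
    obtain ⟨y, hy⟩ := this x hx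
    exact ⟨Z, 𝟙 Z, inferInstance, y, (Category.id_comp _).trans hy⟩
  intro Z x hx
  have hx' (n : ℕ) : x ≫ (p n).f i = (x ≫ (p (n + 1)).f i) ≫ (r n).f i := by
    rw [← sub_eq_zero, Category.assoc, ← Preadditive.comp_sub, ← hg', reassoc_of% hx, zero_comp]
  obtain ⟨y, hy⟩ : ∃ y : Z ⟶ K.X i, y ≫ (K.πTruncGE (-N : ℤ)).f i = x ≫ (p N).f i :=
    ⟨x ≫ (p N).f i ≫ inv ((K.πTruncGE (-N : ℤ)).f i), by simp⟩
  refine ⟨y, hp.hom_ext (fun n ↦ ?_)⟩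
  rw [Category.assoc, hf']
  -- Agreement at stage `N` propagates upwards by cancelling the isomorphisms `r n`, and downwards
  -- by composing with `r n`.
  by_cases hn : N ≤ n
  · induction n, hn using Nat.le_induction with
    | base => exact hy.symm
    | succ n hn h =>
      have := hiso n hn
      have := hiso (n + 1) (by lia)
      have : IsIso ((r n).f i) := IsIso.of_isIso_fac_left (hr' n i)
      rw [← cancel_mono ((r n).f i), ← hx', h, Category.assoc, hr']
  · obtain ⟨d, hd⟩ := Nat.exists_eq_add_of_le (not_le.1 hn).le
    clear hn
    induction d generalizing n with
    | zero =>
      obtain rfl : n = N := by lia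
      exact hy.symm
    | succ d h => rw [hx', h (n + 1) (by lia), Category.assoc, hr']

end CochainComplex

namespace DerivedCategory

open TStructure

variable [HasDerivedCategory.{w₂} A]

/-- A triangulated subcategory of the derived category which contains the objects of the abelian
category and is stable under countable termwise products contains all bounded above objects. -/
lemma prop_of_minus [HasProductsOfShape ℕ A] (hP : IsSeparator P) [Projective P]
    (S : ObjectProperty (DerivedCategory A)) [S.IsTriangulated] [S.IsClosedUnderIsomorphisms]
    (hS : ∀ X : A, S ((singleFunctor A 0).obj X))
    (hS' : ∀ {K : ℕ → CochainComplex A ℤ} {T : CochainComplex A ℤ} {p : ∀ n, T ⟶ K n},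
      CochainComplex.IsTermwiseProduct p → (∀ n, S (Q.obj (K n))) → S (Q.obj T))
    {Y : DerivedCategory A} (hY : t.minus Y) : S Y := by
  obtain ⟨b, K, e, _⟩ := hY
  obtain ⟨T, p, f, g, zero, hp, h⟩ := K.exists_shortExact_truncGE hP
  have hT : S (Q.obj T) := hS' hp (fun n ↦ prop_of_isGE_of_isLE S hS _ (-n : ℤ) b)
  exact S.prop_of_iso e.symm
    (S.ext_of_isTriangulatedClosed₁ _ (triangleOfSES_distinguished h) hT hT)

end DerivedCategory

end

/-! ### Comparison of Hom groups along an exact functor -/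

noncomputable section

namespace CategoryTheory.Functor

open _root_.DerivedCategory _root_.DerivedCategory.TStructure

variable {C : Type u₁} [Category.{v₁} C] [Abelian C] [HasDerivedCategory.{w₁} C]
  {D : Type u₂} [Category.{v₂} D] [Abelian D] [HasDerivedCategory.{w₂} D]
  (F : C ⥤ D) [F.Additive] [PreservesFiniteLimits F] [PreservesFiniteColimits F]

lemma isLE_mapDerivedCategory_obj (X : DerivedCategory C) (n : ℤ) [X.IsLE n] :
    (F.mapDerivedCategory.obj X).IsLE n := by
  obtain ⟨K, _, ⟨e⟩⟩ := exists_iso_Q_obj_of_isLE X n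
  have : (Q.obj ((F.mapHomologicalComplex (.up ℤ)).obj K)).IsLE n := inferInstance
  exact t.isLE_of_iso (X := Q.obj ((F.mapHomologicalComplex (.up ℤ)).obj K))
    (F.mapDerivedCategory.mapIso e ≪≫ F.mapDerivedCategoryFactors.app K).symm n

lemma isGE_mapDerivedCategory_obj (X : DerivedCategory C) (n : ℤ) [X.IsGE n] :
    (F.mapDerivedCategory.obj X).IsGE n := by
  obtain ⟨K, _, ⟨e⟩⟩ := exists_iso_Q_obj_of_isGE X n
  have : (Q.obj ((F.mapHomologicalComplex (.up ℤ)).obj K)).IsGE n := inferInstance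
  exact t.isGE_of_iso (X := Q.obj ((F.mapHomologicalComplex (.up ℤ)).obj K))
    (F.mapDerivedCategory.mapIso e ≪≫ F.mapDerivedCategoryFactors.app K).symm n

lemma bijectiveOn_mapDerivedCategory_of_isLE_of_isGE (X Y : DerivedCategory C) (a b : ℤ)
    (hab : a < b) [X.IsLE a] [Y.IsGE b] : F.mapDerivedCategory.BijectiveOn X Y := by
  have := F.isLE_mapDerivedCategory_obj X a
  have := F.isGE_mapDerivedCategory_obj Y b
  exact .mk' (fun f _ ↦ t.zero f a b) (fun f ↦ ⟨0, by rw [t.zero f a b, Functor.map_zero]⟩)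

lemma bijectiveOn_mapDerivedCategory_of_isTermwiseProduct {J : Type w₃}
    [HasProductsOfShape J C] [HasProductsOfShape J D] [PreservesLimitsOfShape (Discrete J) F]
    {P : C} (hP : IsSeparator P) [Projective P] {P' : D} (hP' : IsSeparator P') [Projective P']
    {K : J → CochainComplex C ℤ} {T : CochainComplex C ℤ} {p : ∀ j, T ⟶ K j}
    (hp : CochainComplex.IsTermwiseProduct p) {X : DerivedCategory C}
    (h : ∀ j, F.mapDerivedCategory.BijectiveOn X (Q.obj (K j))) :
    F.mapDerivedCategory.BijectiveOn X (Q.obj T) := by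
  refine ⟨fun f g hfg ↦ ?_, fun f ↦ ?_⟩
  · exact (existsUnique_lift_of_isTermwiseProduct hP hp (fun j ↦ g ≫ Q.map (p j))).unique
      (fun j ↦ (h j).1 (by rw [Functor.map_comp, hfg, Functor.map_comp])) (fun _ ↦ rfl)
  · choose g hg using fun j ↦ (h j).2 (f ≫ F.mapDerivedCategory.map (Q.map (p j)))
    obtain ⟨g', hg', -⟩ := existsUnique_lift_of_isTermwiseProduct hP hp g
    refine ⟨g', ?_⟩
    -- The product property in the target concerns `Q` of the mapped complex, whence this
    -- identification.
    rw [← cancel_mono (F.mapDerivedCategoryFactors.hom.app T)]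
    refine (existsUnique_lift_of_isTermwiseProduct hP' (hp.map F) (fun j ↦
      F.mapDerivedCategory.map (g j) ≫ F.mapDerivedCategoryFactors.hom.app (K j))).unique
        (fun j ↦ ?_) (fun j ↦ ?_)
    · rw [Category.assoc, ← F.mapDerivedCategoryFactors_hom_naturality, ← Functor.map_comp_assoc,
        hg']
    · rw [Category.assoc, ← F.mapDerivedCategoryFactors_hom_naturality, hg, Category.assoc]

lemma bijectiveOn_mapDerivedCategory_of_isGE (X Y : DerivedCategory C) (hX : t.minus X) (b : ℤ)
    [Y.IsGE b]
    (h : ∀ (X' : DerivedCategory C) (c d : ℤ) [X'.IsGE c] [X'.IsLE d],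
      F.mapDerivedCategory.BijectiveOn X' Y) :
    F.mapDerivedCategory.BijectiveOn X Y := by
  obtain ⟨a, _⟩ := hX
  have h₁ : ((t.truncLT b).obj X).IsLE (b - 1) := inferInstance
  have h₁' : (((t.truncLT b).obj X)⟦(1 : ℤ)⟧).IsLE (b - 1) := by
    have := t.isLE_shift ((t.truncLT b).obj X) (b - 1) 1 (b - 2)
    exact t.isLE_of_le _ (b - 2) _
  have := t.isGE_shift ((t.truncGE b).obj X) b (-1) (b + 1)
  have := t.isLE_shift ((t.truncGE b).obj X) a (-1) (a + 1)
  exact .of_triangle_left (t.triangleLTGE_distinguished b X)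
    (F.bijectiveOn_mapDerivedCategory_of_isLE_of_isGE ((t.truncLT b).obj X) Y (b - 1) b (by lia))
    (h ((t.truncGE b).obj X) b a)
    (F.bijectiveOn_mapDerivedCategory_of_isLE_of_isGE (((t.truncLT b).obj X)⟦(1 : ℤ)⟧) Y
      (b - 1) b (by lia))
    (h (((t.truncGE b).obj X)⟦(-1 : ℤ)⟧) (b + 1) (a + 1))

/-- The two maps are conjugate through the compatibilities of `F` with shifts and single functors.
-/
lemma bijective_mapExactFunctor_iff [HasExt.{w₃} C] [HasExt.{v} D] (X Y : C) (i : ℕ) :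
    Function.Bijective (fun e : Abelian.Ext.{w₃} X Y i ↦
      (e.mapExactFunctor F : Abelian.Ext.{v} (F.obj X) (F.obj Y) i)) ↔
    F.mapDerivedCategory.BijectiveOn ((singleFunctor C 0).obj X)
      (((singleFunctor C 0).obj Y)⟦(i : ℤ)⟧) := by
  let e := Iso.homCongr ((F.mapDerivedCategorySingleFunctor 0).app X)
    ((F.mapDerivedCategory.commShiftIso (i : ℤ)).app ((singleFunctor C 0).obj Y) ≪≫
      (shiftFunctor _ (i : ℤ)).mapIso ((F.mapDerivedCategorySingleFunctor 0).app Y))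
  have h : Abelian.Ext.homEquiv ∘ (fun e : Abelian.Ext.{w₃} X Y i ↦
      (e.mapExactFunctor F : Abelian.Ext.{v} (F.obj X) (F.obj Y) i)) =
      e ∘ F.mapDerivedCategory.map ∘ Abelian.Ext.homEquiv := by
    ext x
    refine (Abelian.Ext.mapExactFunctor_hom F x).trans ?_
    simp [e, Iso.homCongr, ShiftedHom.map]
  rw [← Function.Bijective.of_comp_iff' Abelian.Ext.homEquiv.bijective, h,
    Function.Bijective.of_comp_iff' e.bijective,
    Function.Bijective.of_comp_iff _ Abelian.Ext.homEquiv.bijective]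
  rfl

lemma bijectiveOn_mapDerivedCategoryMinus_iff (X Y : DerivedCategory.Minus C) :
    F.mapDerivedCategoryMinus.BijectiveOn X Y ↔ F.mapDerivedCategory.BijectiveOn X.obj Y.obj := by
  have h₁ : Function.Bijective (Minus.ι.map : (X ⟶ Y) → _) :=
    ⟨Minus.ι.map_injective, Minus.ι.map_surjective⟩
  have h₂ : Function.Bijective (Minus.ι.map :
      (F.mapDerivedCategoryMinus.obj X ⟶ F.mapDerivedCategoryMinus.obj Y) → _) :=
    ⟨Minus.ι.map_injective, Minus.ι.map_surjective⟩
  rw [BijectiveOn, BijectiveOn, ← Function.Bijective.of_comp_iff' h₂]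
  exact (Function.Bijective.of_comp_iff F.mapDerivedCategory.map h₁)

/-- Let `F` be an exact functor preserving countable products between abelian categories which
have countable products and projective separators. If `F` induces bijections on all `Ext`-groups,
then it induces bijections on the morphisms in the bounded above derived categories. -/
lemma bijectiveOn_mapDerivedCategory_of_minus
    [HasProductsOfShape ℕ C] [HasProductsOfShape ℕ D] [PreservesLimitsOfShape (Discrete ℕ) F]
    {P : C} (hP : IsSeparator P) [Projective P] {P' : D} (hP' : IsSeparator P') [Projective P']
    (h : ∀ (X Y : C) (i : ℕ), F.mapDerivedCategory.BijectiveOn ((singleFunctor C 0).obj X)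
      (((singleFunctor C 0).obj Y)⟦(i : ℤ)⟧))
    (X Y : DerivedCategory C) (hX : t.minus X) (hY : t.minus Y) :
    F.mapDerivedCategory.BijectiveOn X Y := by
  have h₀ (X Y : C) :
      F.mapDerivedCategory.bijectiveOnRight ((singleFunctor C 0).obj X)
        ((singleFunctor C 0).obj Y) := by
    intro n
    obtain hn | hn := le_or_gt 0 n
    · obtain ⟨i, rfl⟩ := Int.eq_ofNat_of_zero_le hn
      exact h X Y i
    -- For `n < 0` both Hom groups vanish.
    · have := t.isGE_shift ((singleFunctor C 0).obj Y) 0 n (-n)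
      exact F.bijectiveOn_mapDerivedCategory_of_isLE_of_isGE _ _ 0 (-n) (by lia)
  have h₁ (X : DerivedCategory C) (c d : ℤ) [X.IsGE c] [X.IsLE d] (Y : C) :
      F.mapDerivedCategory.bijectiveOnLeft ((singleFunctor C 0).obj Y) X :=
    prop_of_isGE_of_isLE _ (fun X ↦ h₀ X Y) X c d
  have h₂ (Y : C) : F.mapDerivedCategory.bijectiveOnRight X ((singleFunctor C 0).obj Y) := by
    intro n
    have := t.isGE_shift ((singleFunctor C 0).obj Y) 0 n (-n)
    exact F.bijectiveOn_mapDerivedCategory_of_isGE X _ hX (-n) (fun X' c d _ _ ↦ h₁ X' c d Y n)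
  have h₃ : F.mapDerivedCategory.bijectiveOnRight X Y := by
    refine prop_of_minus hP _ h₂ (fun {K T p} hp hK n ↦ ?_) hY
    refine (F.bijectiveOn_mapDerivedCategory_of_isTermwiseProduct hP hP' (hp.shift n)
      (X := X) (fun j ↦ ?_)).of_iso (Iso.refl _) ((Q.commShiftIso n).app T)
    exact (hK j n).of_iso (Iso.refl _) ((Q.commShiftIso n).symm.app (K j))
  exact (h₃ 0).of_iso (Iso.refl _) ((shiftFunctorZero _ ℤ).app Y)

end CategoryTheory.Functor

/-! ### The functor `Hom(P, -)` and the equivalence -/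

section

variable {B : Type u} [Category.{v} B] [Abelian B] (P : B) {R : Type v} [Ring R]
  (θ : R →+* (End P)ᵐᵒᵖ)

instance : PreservesLimitsOfShape (Discrete ℕ) (homFunctor P θ) := by
  have : PreservesLimitsOfShape (Discrete ℕ) (ModuleCat.restrictScalars.{v} θ) := ⟨inferInstance⟩
  have : PreservesLimitsOfSize.{0, 0} (preadditiveCoyonedaObj P) :=
    preservesSmallestLimits_of_preservesLimits (preadditiveCoyonedaObj P)
  exact comp_preservesLimitsOfShape (preadditiveCoyonedaObj P) _

end

end

theorem mainTheorem8 {B : Type u} [Category.{v} B] [Abelian B] [IsLocallyPresentable.{v} B]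
    (P : B) [Projective P] (hP : IsSeparator P)
    {R : Type v} [Ring R] (θ : R →+* (End P)ᵐᵒᵖ)
    [HasExt.{w₁} B] [HasDerivedCategory.{w₂} B]
    [HasDerivedCategory.{w₃} (ModuleCat.{v} R)] :
    (∀ (X Y : B) (i : ℕ), Function.Bijective
      (fun e : Abelian.Ext.{w₁} X Y i ↦ (e.mapExactFunctor (homFunctor P θ) :
        Abelian.Ext.{v} ((homFunctor P θ).obj X) ((homFunctor P θ).obj Y) i))) ↔
    ((homFunctor P θ).mapDerivedCategoryMinus.Full ∧
      (homFunctor P θ).mapDerivedCategoryMinus.Faithful) := by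
  simp only [Functor.bijective_mapExactFunctor_iff]
  -- Local presentability provides colimits; together with the separator these give limits, hence
  -- countable products.
  have : HasSeparator B := ⟨⟨P, hP⟩⟩
  have : HasColimits B := by
    obtain ⟨κ, _, _⟩ := IsLocallyPresentable.exists_cardinal.{v} B
    infer_instance
  have : HasLimits B := hasLimits_of_hasColimits_of_hasSeparator
  constructor
  · intro h
    have h' (X Y : DerivedCategory.Minus B) :
        (homFunctor P θ).mapDerivedCategoryMinus.BijectiveOn X Y := by
      rw [Functor.bijectiveOn_mapDerivedCategoryMinus_iff]
      exact (homFunctor P θ).bijectiveOn_mapDerivedCategory_of_minus hP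
        (ModuleCat.isSeparator R) h _ _ X.property Y.property
    exact ⟨⟨(h' _ _).2⟩, ⟨fun h ↦ (h' _ _).1 h⟩⟩
  · rintro ⟨_, _⟩ X Y i
    have hX : DerivedCategory.TStructure.t.minus ((DerivedCategory.singleFunctor B 0).obj X) :=
      ⟨0, inferInstance⟩
    have hY : DerivedCategory.TStructure.t.minus ((DerivedCategory.singleFunctor B 0).obj Y) :=
      ⟨0, inferInstance⟩
    exact ((homFunctor P θ).bijectiveOn_mapDerivedCategoryMinus_iff ⟨_, hX⟩
      ⟨_, ObjectProperty.le_shift _ (i : ℤ) _ hY⟩).1 (Functor.bijectiveOn_of_fullyFaithful _ _)
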